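/- Let $b=(b_{ij})\in\mathbb R^{2\times2}$, $c\in\mathbb R_+^2$, and let $m_1,m_2$ be $\sigma$-finite Borel measures on $\mathbb R_+^2$ with $m_i(\{0\})=0$ such that $$\int (z_1\wedge z_1^2+z_2)\,m_1(dz)+\int (z_2\wedge z_2^2+z_1)\,m_2(dz)<\infty,\qquad b_{12}+\int z_2\,m_1(dz)\le 0,\qquad b_{21}+\int z_1\,m_2(dz)\le 0 ,$$ and assume $\Delta:=(\operatorname{tr} b)^2-4\det b>0$. For $\lambda\in\mathbb R_+^2$ and $i=1,2$ let $$\phi_i(\lambda)=b_{i1}\lambda_1+b_{i2}\lambda_2+c_i\lambda_i^2+\int_{\mathbb R_+^2}\bigl(e^{-\langle\lambda,z\rangle}-1+\langle\lambda,z\rangle\bigr)\,m_i(dz).$$ Let $a\in\mathbb R$, $\sigma\ge 0$, let $\nu$ be a Borel measure on $\mathbb R$ with $\nu(\{0\})=0$ and $\int_{\mathbb R}(1\wedge z^2)\,\nu(dz)<\infty$, and let $\xi=(\xi(t))_{t\ge0}$ be a Lévy process (with càdlàg paths, $\xi(0)=0$) on a probability space with expectation $\mathbf P$, with drift $a$,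 Gaussian coefficient $\sigma$ and Lévy measure $\nu$ relative to the truncation set $[-1,1]$, i.e. $$\mathbf P\bigl[e^{iu\xi(t)}\bigr]=\exp\Bigl\{t\Bigl(iau-\tfrac{\sigma^2u^2}{2}+\int_{[-1,1]}(e^{iuz}-1-iuz)\,\nu(dz)+\int_{[-1,1]^c}(e^{iuz}-1)\,\nu(dz)\Bigr)\Bigr\},\qquad u\in\mathbb R.$$ For $0\le r\le t$ and $\lambda\in\mathbb R_+^2$ let $r\mapsto u_{r,t}(\xi,\lambda)\in\mathbb R_+^2$ be the unique solution of $$u^{(i)}_{r,t}(\xi,\lambda)=\lambda_i-\int_r^t e^{\xi(s)}\phi_i\bigl(e^{-\xi(s)}u_{s,t}(\xi,\lambda)\bigr)\,ds,\qquad i=1,2,\ 0\le r\le t,$$ and put $v_{r,t}(\xi,\lambda)=e^{-\xi(r)}u_{r,t}(\xi,e^{\xi(t)}\lambda)$. Let $(Q_t)_{t\ge0}$ be the transition semigroup on $\mathbb R_+^2$ of the two-type continuous-state branching process in the random environment $\xi$ (CBRE-process, without immigration), which is determined by $$\int_{\mathbb R_+^2}e^{-\langle\lambda,y\rangle}\,Q_t(x,dy)=\mathbf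 P\bigl[\exp\{-\langle x,v_{0,t}(\xi,\lambda)\rangle\}\bigr],\qquad \lambda,x\in\mathbb R_+^2,\ t\ge0.$$ Let $$\beta=a+\frac{\sigma^2}{2}+\int_{[-1,1]}(e^z-1-z)\,\nu(dz)+\int_{[-1,1]^c}(e^z-1)\,\nu(dz).$$ For a metric $d$ on $\mathbb R_+^2$ let $W_d(\mu_1,\mu_2)=\inf_\Pi\int d(x,y)\,\Pi(dx,dy)$, the infimum being over all couplings $\Pi$ of $\mu_1$ and $\mu_2$; let $W_1$ be $W_d$ for the Euclidean metric $d(x,y)=|x-y|$, and for $\theta>0$ let $d^\theta(x,y)=(1+\theta)|x-y|$. Assume $\int_1^\infty e^z\,\nu(dz)<\infty$ and $\beta<\tfrac12(\operatorname{tr}(b)-\sqrt\Delta)$. Then there exist $\rho>0$ and $\theta>0$ such that for all $x\in\mathbb R_+^2$ and all $t\ge0$, $$W_1(\delta_xQ_t,\delta_0)\le W_{d^\theta}(\delta_x,\delta_0)\,e^{-\rho t}.$$ -/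

import Mathlib

open MeasureTheory ProbabilityTheory Filter Topology
open scoped NNReal ENNReal

noncomputable section

namespace CBRE

/-- The plane `ℝ²` with its Euclidean norm and inner product. -/
abbrev Plane : Type := EuclideanSpace ℝ (Fin 2)

/-- The closed quadrant `ℝ₊²`, with the metric, topology and Borel σ-algebra of the plane.
The two coordinates are indexed by `0` and `1`. -/
abbrev Quadrant : Type := {x : Plane // ∀ i, 0 ≤ x i}

/-- The origin of the quadrant. -/
def origin : Quadrant := ⟨0, fun i => by simp⟩

/-- Multiplication of a point of the quadrant by the positive number `e^s`. -/
def expScale (s : ℝ) (x : Quadrant) : Quadrant :=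
  ⟨Real.exp s • x.1, fun i => by
    simpa using mul_nonneg (Real.exp_pos s).le (x.2 i)⟩

/-! ### Branching mechanisms -/

/-- The parameters `(b, c, m₁, m₂)` of a two-type branching mechanism. -/
structure BranchingMechanism where
  b : Matrix (Fin 2) (Fin 2) ℝ
  c : Fin 2 → ℝ
  m : Fin 2 → Measure Quadrant
  c_nonneg : ∀ i, 0 ≤ c i
  sigmaFinite_m : ∀ i, SigmaFinite (m i)
  m_origin : ∀ i, m i {origin} = 0
  integrable_m_zero :
    Integrable (fun z : Quadrant => min (z.1 0) (z.1 0 ^ 2) + z.1 1) (m 0)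
  integrable_m_one :
    Integrable (fun z : Quadrant => min (z.1 1) (z.1 1 ^ 2) + z.1 0) (m 1)
  b_zero_one : b 0 1 + ∫ z : Quadrant, z.1 1 ∂(m 0) ≤ 0
  b_one_zero : b 1 0 + ∫ z : Quadrant, z.1 0 ∂(m 1) ≤ 0

namespace BranchingMechanism

/-- The branching mechanism `φ = (φ₁, φ₂)`:
`φᵢ(l) = bᵢ₁ l₁ + bᵢ₂ l₂ + cᵢ lᵢ² + ∫ (e^{-⟨l, z⟩} - 1 + ⟨l, z⟩) mᵢ(dz)`. -/
def phi (M : BranchingMechanism) (i : Fin 2) (l : Quadrant) : ℝ :=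
  M.b i 0 * l.1 0 + M.b i 1 * l.1 1 + M.c i * l.1 i ^ 2 +
    ∫ z : Quadrant, (Real.exp (-(inner ℝ l.1 z.1)) - 1 + inner ℝ l.1 z.1) ∂(M.m i)

/-- `Δ = (tr b)² - 4 det b`. -/
def disc (M : BranchingMechanism) : ℝ := M.b.trace ^ 2 - 4 * M.b.det

/-- `u : r ↦ u_{r,t}` is a (nonnegative, continuous) solution on `[0, t]` of
`u_{r,t}^{(i)} = lᵢ - ∫_r^t e^{ζ(s)} φᵢ(e^{-ζ(s)} u_{s,t}) ds`. -/
def IsCumulantSolution (M : BranchingMechanism) (ζ : ℝ≥0 → ℝ) (t : ℝ≥0) (l : Quadrant)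
    (u : ℝ → Quadrant) : Prop :=
  ContinuousOn u (Set.Icc 0 (t : ℝ)) ∧
    ∀ r ∈ Set.Icc 0 (t : ℝ), ∀ i : Fin 2,
      (u r).1 i = l.1 i - ∫ s in r..(t : ℝ),
        Real.exp (ζ s.toNNReal) * M.phi i (expScale (-ζ s.toNNReal) (u s))

open Classical in
/-- The cumulant `u_{r,t}(ζ, l)`, `0 ≤ r ≤ t`: the solution of the backward integral equation
(which exists and is unique on `[0, t]` for every càdlàg path `ζ`). -/
def cumulantU (M : BranchingMechanism) (ζ : ℝ≥0 → ℝ) (r t : ℝ≥0) (l : Quadrant) : Quadrant :=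
  if h : ∃ u, M.IsCumulantSolution ζ t l u then h.choose r else origin

/-- `v_{r,t}(ζ, l) = e^{-ζ(r)} u_{r,t}(ζ, e^{ζ(t)} l)`. -/
def cumulantV (M : BranchingMechanism) (ζ : ℝ≥0 → ℝ) (r t : ℝ≥0) (l : Quadrant) : Quadrant :=
  expScale (-ζ r) (M.cumulantU ζ r t (expScale (ζ t) l))

end BranchingMechanism

/-! ### The Lévy environment -/

/-- A Lévy triplet: drift `a`, Gaussian coefficient `σ ≥ 0`, Lévy measure `ν`. -/
structure LevyTriplet where
  a : ℝ
  σ : ℝ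
  ν : Measure ℝ
  σ_nonneg : 0 ≤ σ
  ν_zero : ν {0} = 0
  integrable_ν : Integrable (fun z : ℝ => min 1 (z ^ 2)) ν

namespace LevyTriplet

/-- The characteristic exponent
`iau - σ²u²/2 + ∫_{[-1,1]} (e^{iuz} - 1 - iuz) ν(dz) + ∫_{[-1,1]ᶜ} (e^{iuz} - 1) ν(dz)`. -/
def exponent (L : LevyTriplet) (u : ℝ) : ℂ :=
  Complex.I * L.a * u - (L.σ : ℂ) ^ 2 * u ^ 2 / 2
    + (∫ z in Set.Icc (-1 : ℝ) 1,
        (Complex.exp (Complex.I * u * z) - 1 - Complex.I * u * z) ∂L.ν)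
    + ∫ z in (Set.Icc (-1 : ℝ) 1)ᶜ, (Complex.exp (Complex.I * u * z) - 1) ∂L.ν

/-- `β = a + σ²/2 + ∫_{[-1,1]} (e^z - 1 - z) ν(dz) + ∫_{[-1,1]ᶜ} (e^z - 1) ν(dz)`. -/
def beta (L : LevyTriplet) : ℝ :=
  L.a + L.σ ^ 2 / 2
    + (∫ z in Set.Icc (-1 : ℝ) 1, (Real.exp z - 1 - z) ∂L.ν)
    + ∫ z in (Set.Icc (-1 : ℝ) 1)ᶜ, (Real.exp z - 1) ∂L.ν

end LevyTriplet

/-- A càdlàg path: right-continuous with finite left limits. -/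
def IsCadlagPath (ζ : ℝ≥0 → ℝ) : Prop :=
  ∀ t, ContinuousWithinAt ζ (Set.Ici t) t ∧ ∃ y, Tendsto ζ (𝓝[<] t) (𝓝 y)

/-- `ξ` is a Lévy process with triplet `L`, the truncation being `[-1, 1]`. -/
structure IsLevyProcess {Ω : Type*} [MeasurableSpace Ω] (L : LevyTriplet) (P : Measure Ω)
    (ξ : ℝ≥0 → Ω → ℝ) : Prop where
  measurable : ∀ t, Measurable (ξ t)
  zero : ∀ᵐ ω ∂P, ξ 0 ω = 0
  cadlag : ∀ᵐ ω ∂P, IsCadlagPath (fun t => ξ t ω)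
  indep : HasIndepIncrements ξ P
  stationary : ∀ s t, IdentDistrib (fun ω => ξ (s + t) ω - ξ s ω) (ξ t) P P
  charFun_eq : ∀ (t : ℝ≥0) (u : ℝ),
    charFun (P.map (ξ t)) u = Complex.exp ((t : ℂ) * L.exponent u)

/-! ### The transition semigroup -/

/-- `(Q_t)` is the transition semigroup of the two-type CBRE-process (no immigration) with
branching mechanism `M` in the environment `ξ`: the family of probability kernels on `ℝ₊²`
determined by `∫ e^{-⟨l, y⟩} Q_t(x, dy) = P[exp(-⟨x, v_{0,t}(ξ, l)⟩)]`. -/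
structure IsCBRESemigroup {Ω : Type*} [MeasurableSpace Ω] (M : BranchingMechanism)
    (P : Measure Ω) (ξ : ℝ≥0 → Ω → ℝ) (Q : ℝ≥0 → Kernel Quadrant Quadrant) : Prop where
  markov : ∀ t, IsMarkovKernel (Q t)
  laplace : ∀ (t : ℝ≥0) (x l : Quadrant),
    ∫ y : Quadrant, Real.exp (-(inner ℝ l.1 y.1)) ∂(Q t x) =
      ∫ ω, Real.exp (-(inner ℝ x.1 (M.cumulantV (fun s => ξ s ω) 0 t l).1)) ∂P

/-! ### Wasserstein distances -/

/-- The Wasserstein distance `W_d(μ₁, μ₂)`, with values in `[0, ∞]`: the infimum of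
`∫ d(x, y) Π(dx, dy)` over the couplings `Π` of `μ₁` and `μ₂`. -/
def wasserstein (d : Quadrant → Quadrant → ℝ) (μ₁ μ₂ : Measure Quadrant) : ℝ≥0∞ :=
  ⨅ (p : Measure (Quadrant × Quadrant)) (_ : p.map Prod.fst = μ₁ ∧ p.map Prod.snd = μ₂),
    ∫⁻ z, ENNReal.ofReal (d z.1 z.2) ∂p

/-- The Euclidean metric `d₁(x, y) = |x - y|`. -/
def dOne (x y : Quadrant) : ℝ := ‖x.1 - y.1‖

/-- The metric `d^θ(x, y) = (1 + θ)|x - y|`. -/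
def dTheta (θ : ℝ) (x y : Quadrant) : ℝ := (1 + θ) * ‖x.1 - y.1‖

end CBRE

end

/-! Against `δ_0` there is only one coupling, so the claim is an exponential bound on the first
moment of `Q_t(x, ·)`, with a constant that `θ` may absorb.

Dropping the quadratic and jump terms, both nonnegative, leaves `φ ≥ bλ`. The off-diagonal entries
of `b` are nonpositive, so for every `κ` below its smaller eigenvalue there is a strictly positive
row vector `p` with `p b ≥ κ p` (`exists_left_subeigenvector`). Pairing the cumulant equation with
`p` cancels the environment in the linear part, and a backward Grönwall inequality gives `⟨p,
v_{0,t}(λ)⟩ ≤ ⟨p, λ⟩ e^{ξ(t) - κt}` (`cumulantV_le`). Only solutions are estimated; their existence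
plays no role.

Since `P[e^{ξ(t)}] ≤ e^{βt}` (`LevyTriplet.lintegral_exp_le`), the Laplace transform at `λ = (ε,
ε)`, divided by `ε` as `ε → 0`, bounds the first moment by a multiple of `|x| e^{(β - κ)t}`.
Choosing `κ` strictly between `β` and the smaller eigenvalue makes the rate negative. -/

/-! ### Compound Poisson distributions -/

namespace CompoundPoisson

/-- The convolution powers of a measure on the real line. -/
noncomputable def convPow (μ : Measure ℝ) : ℕ → Measure ℝ
  | 0 => Measure.dirac 0
  | n + 1 => μ ∗ convPow μ n

/-- The compound Poisson distribution with finite jump measure `μ`. -/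
noncomputable def law (μ : Measure ℝ) : Measure ℝ :=
  Measure.sum fun n =>
    ENNReal.ofReal (Real.exp (-μ.real Set.univ) * (n.factorial : ℝ)⁻¹) • convPow μ n

variable (μ : Measure ℝ) [IsFiniteMeasure μ]

instance isFiniteMeasure_convPow (n : ℕ) : IsFiniteMeasure (convPow μ n) := by
  induction n with
  | zero => simp only [convPow]; infer_instance
  | succ n ih => simp only [convPow]; infer_instance

lemma lintegral_convPow {f : ℝ → ℝ≥0∞} (hf : Measurable f) (h0 : f 0 = 1)
    (hadd : ∀ x y, f (x + y) = f x * f y) (n : ℕ) :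
    ∫⁻ x, f x ∂(convPow μ n) = (∫⁻ x, f x ∂μ) ^ n := by
  induction n with
  | zero => simp [convPow, h0]
  | succ n ih =>
    rw [convPow, Measure.lintegral_conv hf]
    simp_rw [hadd, lintegral_const_mul _ hf, ih]
    rw [lintegral_mul_const _ hf, pow_succ']

/-- A multiplicative `f` integrates to `A ^ n` against the `n`-th convolution power, so the Poisson
weights produce an exponential series. The case `f = exp` gives the exponential moment, the case `f
= 1` the total mass. -/
lemma lintegral_law {f : ℝ → ℝ≥0∞} (hf : Measurable f) (h0 : f 0 = 1)
    (hadd : ∀ x y, f (x + y) = f x * f y) {A : ℝ} (hA : 0 ≤ A)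
    (h : ∫⁻ x, f x ∂μ = ENNReal.ofReal A) :
    ∫⁻ x, f x ∂(law μ) = ENNReal.ofReal (Real.exp (A - μ.real Set.univ)) := by
  have hs := (NormedSpace.expSeries_div_hasSum_exp A).mul_left (Real.exp (-μ.real Set.univ))
  rw [← Real.exp_eq_exp_ℝ, ← Real.exp_add, neg_add_eq_sub] at hs
  rw [law, lintegral_sum_measure, ← hs.tsum_eq,
    ENNReal.ofReal_tsum_of_nonneg (fun n => by positivity) hs.summable]
  refine tsum_congr fun n => ?_
  rw [lintegral_smul_measure, lintegral_convPow μ hf h0 hadd, h, ← ENNReal.ofReal_pow hA,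
    smul_eq_mul, ← ENNReal.ofReal_mul (by positivity)]
  congr 1
  ring

lemma lintegral_exp_law (h : Integrable Real.exp μ) :
    ∫⁻ x, ENNReal.ofReal (Real.exp x) ∂(law μ) =
      ENNReal.ofReal (Real.exp (∫ x, (Real.exp x - 1) ∂μ)) := by
  rw [integral_sub h (integrable_const _), integral_const, smul_eq_mul, mul_one]
  refine lintegral_law μ (by fun_prop) (by simp) (fun x y => ?_)
    (integral_nonneg fun x => (Real.exp_pos x).le) ?_
  · rw [Real.exp_add, ENNReal.ofReal_mul (Real.exp_pos x).le]
  · exact (ofReal_integral_eq_lintegral_ofReal h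
      (Eventually.of_forall fun x => (Real.exp_pos x).le)).symm

instance isProbabilityMeasure_law : IsProbabilityMeasure (law μ) := by
  constructor
  have := lintegral_law μ (f := fun _ => 1) measurable_const rfl (by simp)
    (A := μ.real Set.univ) measureReal_nonneg (by simp [measureReal_def])
  simpa using this

lemma charFun_convPow (n : ℕ) (u : ℝ) : charFun (convPow μ n) u = charFun μ u ^ n := by
  induction n with
  | zero => simp [convPow]
  | succ n ih => rw [convPow, charFun_conv, ih, pow_succ']

lemma charFun_law (u : ℝ) :
    charFun (law μ) u = Complex.exp (charFun μ u - μ.real Set.univ) := by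
  have hi : Integrable (fun x : ℝ => Complex.exp (inner ℝ x u * Complex.I)) (law μ) := by
    refine Integrable.of_bound (C := 1) (by fun_prop) (Eventually.of_forall fun x => ?_)
    rw [Complex.norm_exp_ofReal_mul_I]
  have hs := (NormedSpace.expSeries_div_hasSum_exp (charFun μ u)).mul_left
    (Complex.exp (-μ.real Set.univ))
  rw [← Complex.exp_eq_exp_ℂ, ← Complex.exp_add, neg_add_eq_sub] at hs
  refine (hasSum_integral_measure hi).unique (hs.congr_fun ?_)
  intro n
  rw [integral_smul_measure, ENNReal.toReal_ofReal (by positivity), ← charFun_apply,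
    charFun_convPow, Complex.real_smul]
  push_cast
  ring

end CompoundPoisson

/-! ### Exponential moments of infinitely divisible distributions -/

namespace CBRE

namespace LevyTriplet

/-- The jumps of size larger than `1 / (n + 1)`. -/
def bigJumps (n : ℕ) : Set ℝ := {z | 1 / ((n : ℝ) + 1) < |z|}

lemma measurableSet_bigJumps (n : ℕ) : MeasurableSet (bigJumps n) :=
  measurableSet_lt measurable_const (by fun_prop)

lemma bigJumps_mono : Monotone bigJumps := by
  intro m n h z hz
  refine lt_of_le_of_lt (b := 1 / ((m : ℝ) + 1)) ?_ hz
  exact one_div_le_one_div_of_le (by positivity) (by gcongr)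

lemma compl_Icc_subset_bigJumps (n : ℕ) : (Set.Icc (-1 : ℝ) 1)ᶜ ⊆ bigJumps n := by
  intro z hz
  have h1 : 1 < |z| := by
    by_contra! h
    exact hz (abs_le.mp h)
  refine lt_of_le_of_lt ?_ h1
  rw [div_le_one (by positivity)]
  linarith [(Nat.cast_nonneg n : (0 : ℝ) ≤ n)]

lemma iUnion_Icc_inter_bigJumps :
    ⋃ n, (Set.Icc (-1 : ℝ) 1 ∩ bigJumps n) = Set.Icc (-1 : ℝ) 1 \ {0} := by
  rw [← Set.inter_iUnion, Set.sdiff_eq]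
  congr 1
  ext z
  simp only [Set.mem_iUnion, Set.mem_compl_iff, Set.mem_singleton_iff, bigJumps, Set.mem_ofPred_eq]
  refine ⟨?_, fun h => exists_nat_one_div_lt (abs_pos.mpr h)⟩
  rintro ⟨n, hn⟩ rfl
  rw [abs_zero] at hn
  exact absurd hn (not_lt.mpr (by positivity))

variable (L : LevyTriplet)

/-- Markov's inequality: `min 1 (z ^ 2)` is bounded below on the large jumps. The threshold is
halved because a strict inequality is needed. -/
lemma measure_bigJumps_lt_top (n : ℕ) : L.ν (bigJumps n) < ∞ := by
  have hε : 0 < 1 / ((n : ℝ) + 1) := by positivity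
  have hε1 : 1 / ((n : ℝ) + 1) ≤ 1 := by
    rw [div_le_one (by positivity)]
    linarith [(Nat.cast_nonneg n : (0 : ℝ) ≤ n)]
  refine lt_of_le_of_lt (measure_mono ?_) (L.integrable_ν.measure_norm_gt_lt_top
    (show 0 < (1 / ((n : ℝ) + 1)) ^ 2 / 2 by positivity))
  intro z hz
  replace hz : 1 / ((n : ℝ) + 1) < |z| := hz
  have h2 : (1 / ((n : ℝ) + 1)) ^ 2 ≤ z ^ 2 := by
    rw [← sq_abs z]
    gcongr
  have h3 : (1 / ((n : ℝ) + 1)) ^ 2 ≤ 1 := pow_le_one₀ hε.le hε1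
  have h4 : 0 < (1 / ((n : ℝ) + 1)) ^ 2 := by positivity
  refine lt_of_lt_of_le ?_ (Real.le_norm_self _)
  exact lt_of_lt_of_le (half_lt_self h4) (le_min h3 h2)

instance isFiniteMeasure_bigJumps (n : ℕ) : IsFiniteMeasure (L.ν.restrict (bigJumps n)) :=
  ⟨by simpa using L.measure_bigJumps_lt_top n⟩

lemma measure_compl_Icc_lt_top : L.ν (Set.Icc (-1 : ℝ) 1)ᶜ < ∞ :=
  (measure_mono (compl_Icc_subset_bigJumps 0)).trans_lt (L.measure_bigJumps_lt_top 0)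

/-! ### Integrals over the small jumps. -/

section SmallJumps

variable {E : Type*} [NormedAddCommGroup E] {F : ℝ → E} {C : ℝ}

lemma integrableOn_Icc (hF : Continuous F)
    (h : ∀ z ∈ Set.Icc (-1 : ℝ) 1, ‖F z‖ ≤ C * z ^ 2) :
    IntegrableOn F (Set.Icc (-1) 1) L.ν := by
  refine (L.integrable_ν.integrableOn.const_mul C).mono' hF.aestronglyMeasurable ?_
  filter_upwards [ae_restrict_mem measurableSet_Icc] with z hz
  rw [min_eq_right]
  · exact h z hz
  · rw [sq_le_one_iff_abs_le_one]
    exact abs_le.mpr hz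

/-- The truncated sets increase to `[-1, 1] \ {0}`, and `ν` has no atom at `0`; the quadratic bound
supplies integrability. -/
lemma tendsto_integral_Icc_inter_bigJumps [NormedSpace ℝ E] (hF : Continuous F)
    (h : ∀ z ∈ Set.Icc (-1 : ℝ) 1, ‖F z‖ ≤ C * z ^ 2) :
    Tendsto (fun n => ∫ z in Set.Icc (-1 : ℝ) 1 ∩ bigJumps n, F z ∂L.ν) atTop
      (𝓝 (∫ z in Set.Icc (-1 : ℝ) 1, F z ∂L.ν)) := by
  have h0 : ∫ z in Set.Icc (-1 : ℝ) 1, F z ∂L.ν = ∫ z in Set.Icc (-1 : ℝ) 1 \ {0}, F z ∂L.ν :=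
    setIntegral_congr_set (sdiff_null_ae_eq_self L.ν_zero).symm
  rw [h0, ← iUnion_Icc_inter_bigJumps]
  refine tendsto_setIntegral_of_monotone
    (fun n => measurableSet_Icc.inter (measurableSet_bigJumps n))
    (fun m n hmn => Set.inter_subset_inter_right _ (bigJumps_mono hmn)) ?_
  rw [iUnion_Icc_inter_bigJumps]
  exact (L.integrableOn_Icc hF h).mono_set Set.sdiff_subset

lemma integral_bigJumps [NormedSpace ℝ E] (n : ℕ) (hF : IntegrableOn F (bigJumps n) L.ν) :
    ∫ z in bigJumps n, F z ∂L.ν =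
      (∫ z in Set.Icc (-1 : ℝ) 1 ∩ bigJumps n, F z ∂L.ν) +
        ∫ z in (Set.Icc (-1 : ℝ) 1)ᶜ, F z ∂L.ν := by
  rw [← integral_inter_add_sdiff (t := Set.Icc (-1 : ℝ) 1) measurableSet_Icc hF,
    Set.inter_comm, Set.sdiff_eq, Set.inter_eq_self_of_subset_right (compl_Icc_subset_bigJumps n)]

end SmallJumps

lemma norm_exp_I_sub_one_sub_le (x : ℝ) :
    ‖Complex.exp (Complex.I * x) - 1 - Complex.I * x‖ ≤ 2 * x ^ 2 := by
  rcases le_total |x| 1 with h | h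
  · have := Complex.norm_exp_sub_one_sub_id_le (x := Complex.I * x) (by simpa using h)
    refine this.trans ?_
    simp only [norm_mul, Complex.norm_I, one_mul, Complex.norm_real, Real.norm_eq_abs, sq_abs]
    linarith [sq_nonneg x]
  · calc _ ≤ ‖Complex.exp (Complex.I * x) - 1‖ + ‖Complex.I * x‖ := norm_sub_le _ _
      _ ≤ |x| + |x| := by
        refine add_le_add Real.norm_exp_I_mul_ofReal_sub_one_le (by simp)
      _ ≤ 2 * x ^ 2 := by
        rw [← sq_abs x]
        nlinarith

/-- The mean of the jumps of modulus between `1 / (n + 1)` and `1`. -/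
noncomputable def compensator (n : ℕ) : ℝ := ∫ z in Set.Icc (-1 : ℝ) 1 ∩ bigJumps n, z ∂L.ν

/-- The infinitely divisible law at time `t` without the jumps of modulus at most
`1 / (n + 1)`. -/
noncomputable def approxLaw (t : ℝ≥0) (n : ℕ) : Measure ℝ :=
  gaussianReal (t * (L.a - L.compensator n)) (t * (L.σ ^ 2).toNNReal) ∗
    CompoundPoisson.law (t • L.ν.restrict (bigJumps n))

instance (t : ℝ≥0) (n : ℕ) : IsProbabilityMeasure (L.approxLaw t n) := by
  unfold approxLaw
  infer_instance

lemma integrableOn_Icc_inter (n : ℕ) {E : Type*} [NormedAddCommGroup E] {F : ℝ → E}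
    (hF : Continuous F) : IntegrableOn F (Set.Icc (-1 : ℝ) 1 ∩ bigJumps n) L.ν := by
  obtain ⟨C, hC⟩ := (isCompact_Icc (a := (-1 : ℝ)) (b := 1)).exists_bound_of_continuousOn
    hF.continuousOn
  refine Measure.integrableOn_of_bounded (M := C) ?_ hF.aestronglyMeasurable ?_
  · exact ((measure_mono Set.inter_subset_right).trans_lt (L.measure_bigJumps_lt_top n)).ne
  · filter_upwards [ae_restrict_mem (measurableSet_Icc.inter (measurableSet_bigJumps n))] with z hz
    exact hC z hz.1

/-- The compound Poisson factor is uncompensated; shifting the Gaussian mean by the compensator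
restores the term `-iuz` on `[-1, 1]`. -/
lemma charFun_approxLaw (t : ℝ≥0) (n : ℕ) (u : ℝ) :
    charFun (L.approxLaw t n) u = Complex.exp ((t : ℂ) *
      (Complex.I * L.a * u - (L.σ : ℂ) ^ 2 * u ^ 2 / 2
        + (∫ z in Set.Icc (-1 : ℝ) 1 ∩ bigJumps n,
            (Complex.exp (Complex.I * u * z) - 1 - Complex.I * u * z) ∂L.ν)
        + ∫ z in (Set.Icc (-1 : ℝ) 1)ᶜ, (Complex.exp (Complex.I * u * z) - 1) ∂L.ν)) := by
  have hi : IntegrableOn (fun z : ℝ => Complex.exp (Complex.I * u * z)) (bigJumps n) L.ν := by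
    refine Integrable.of_bound (C := 1) (by fun_prop) (Eventually.of_forall fun x => ?_)
    rw [mul_assoc, mul_comm, ← Complex.ofReal_mul, Complex.norm_exp_ofReal_mul_I]
  have hi1 : IntegrableOn (fun z : ℝ => Complex.exp (Complex.I * u * z) - 1) (bigJumps n) L.ν :=
    hi.sub (integrable_const _)
  have h1 : charFun (t • L.ν.restrict (bigJumps n)) u
      - ((t • L.ν.restrict (bigJumps n)).real Set.univ : ℝ) =
      t * ∫ z in bigJumps n, (Complex.exp (Complex.I * u * z) - 1) ∂L.ν := by
    rw [integral_sub hi (integrable_const _), mul_sub, charFun_apply_real]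
    congr 1
    · rw [integral_smul_nnreal_measure, NNReal.smul_def, Complex.real_smul]
      congr 2
      ext z
      ring_nf
    · simp [measureReal_def]
  have h2 : ∫ z : ℝ in Set.Icc (-1 : ℝ) 1 ∩ bigJumps n, (z : ℂ) ∂L.ν = L.compensator n :=
    integral_complex_ofReal
  rw [approxLaw, charFun_conv, charFun_gaussianReal, CompoundPoisson.charFun_law, h1,
    ← Complex.exp_add, L.integral_bigJumps n hi1,
    integral_sub (f := fun z : ℝ => Complex.exp (Complex.I * u * z) - 1)
      (g := fun z : ℝ => Complex.I * u * z) (L.integrableOn_Icc_inter n (by fun_prop))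
      (L.integrableOn_Icc_inter n (by fun_prop)), integral_const_mul, h2, NNReal.coe_mul,
    Real.coe_toNNReal _ (sq_nonneg L.σ)]
  congr 1
  push_cast
  ring

lemma tendsto_charFun_approxLaw (t : ℝ≥0) (u : ℝ) :
    Tendsto (fun n => charFun (L.approxLaw t n) u) atTop
      (𝓝 (Complex.exp ((t : ℂ) * L.exponent u))) := by
  simp_rw [charFun_approxLaw]
  refine (Complex.continuous_exp.tendsto _).comp (Tendsto.const_mul _ ?_)
  refine (Tendsto.const_add _ ?_).add_const _
  refine L.tendsto_integral_Icc_inter_bigJumps (C := 2 * u ^ 2) (by fun_prop) fun z _ => ?_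
  have := norm_exp_I_sub_one_sub_le (u * z)
  rw [mul_pow, ← mul_assoc] at this
  simpa [mul_assoc] using this

variable {L}

lemma integrableOn_exp_compl_Icc
    (hν : IntegrableOn (fun z : ℝ => Real.exp z) (Set.Ioi 1) L.ν) :
    IntegrableOn Real.exp (Set.Icc (-1 : ℝ) 1)ᶜ L.ν := by
  have h1 : IntegrableOn Real.exp (Set.Iio (-1 : ℝ)) L.ν := by
    refine Measure.integrableOn_of_bounded (M := 1) ?_ Real.continuous_exp.aestronglyMeasurable ?_
    · refine ((measure_mono fun z hz => ?_).trans_lt L.measure_compl_Icc_lt_top).ne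
      exact fun h => absurd h.1 (not_le.mpr hz)
    · filter_upwards [ae_restrict_mem measurableSet_Iio] with z hz
      rw [Real.norm_eq_abs, Real.abs_exp, Real.exp_le_one_iff]
      exact (lt_trans hz (by norm_num)).le
  refine (h1.union hν).mono_set fun z hz => ?_
  simp only [Set.mem_compl_iff, Set.mem_Icc, not_and_or, not_le] at hz
  exact hz

/-- The real counterpart of `charFun_approxLaw`, computed directly from the two convolution factors,
so that no analytic continuation of characteristic functions is needed. -/
lemma lintegral_exp_approxLaw (hν : IntegrableOn (fun z : ℝ => Real.exp z) (Set.Ioi 1) L.ν)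
    (t : ℝ≥0) (n : ℕ) :
    ∫⁻ x, ENNReal.ofReal (Real.exp x) ∂(L.approxLaw t n) =
      ENNReal.ofReal (Real.exp (t * (L.a + L.σ ^ 2 / 2
        + (∫ z in Set.Icc (-1 : ℝ) 1 ∩ bigJumps n, (Real.exp z - 1 - z) ∂L.ν)
        + ∫ z in (Set.Icc (-1 : ℝ) 1)ᶜ, (Real.exp z - 1) ∂L.ν))) := by
  have hi : IntegrableOn Real.exp (bigJumps n) L.ν := by
    refine ((L.integrableOn_Icc_inter n Real.continuous_exp).union
      (integrableOn_exp_compl_Icc hν)).mono_set fun z hz => ?_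
    by_cases h : z ∈ Set.Icc (-1 : ℝ) 1
    exacts [Or.inl ⟨h, hz⟩, Or.inr h]
  have hi1 : IntegrableOn (fun z => Real.exp z - 1) (bigJumps n) L.ν :=
    hi.sub (integrable_const _)
  have hg : ∫⁻ x, ENNReal.ofReal (Real.exp x)
      ∂(gaussianReal (t * (L.a - L.compensator n)) (t * (L.σ ^ 2).toNNReal)) =
      ENNReal.ofReal (Real.exp (t * (L.a - L.compensator n) + t * L.σ ^ 2 / 2)) := by
    have hm := congrFun (mgf_id_gaussianReal (μ := t * (L.a - L.compensator n))
      (v := t * (L.σ ^ 2).toNNReal)) 1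
    have hint := integrable_exp_mul_gaussianReal (μ := t * (L.a - L.compensator n))
      (v := t * (L.σ ^ 2).toNNReal) 1
    simp only [mgf, one_mul, id, one_pow, mul_one] at hm hint
    rw [← ofReal_integral_eq_lintegral_ofReal hint
      (Eventually.of_forall fun x => (Real.exp_pos x).le), hm]
    simp [max_eq_left (sq_nonneg L.σ)]
  rw [approxLaw, Measure.lintegral_conv (by fun_prop)]
  simp_rw [Real.exp_add, ENNReal.ofReal_mul (Real.exp_pos _).le]
  have hme : Measurable fun x => ENNReal.ofReal (Real.exp x) := by fun_prop
  simp_rw [lintegral_const_mul _ hme]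
  rw [lintegral_mul_const _ hme, hg,
    CompoundPoisson.lintegral_exp_law _ (hi.integrable.smul_measure_nnreal),
    ← ENNReal.ofReal_mul (Real.exp_pos _).le, ← Real.exp_add, integral_smul_nnreal_measure,
    L.integral_bigJumps n hi1,
    integral_sub (f := fun z : ℝ => Real.exp z - 1) (g := fun z : ℝ => z)
      (L.integrableOn_Icc_inter n (by fun_prop))
      (L.integrableOn_Icc_inter n (by fun_prop)), compensator, NNReal.smul_def, smul_eq_mul]
  congr 2
  ring

/-- An infinitely divisible law satisfies `E[e^X] ≤ e^{tβ}`. -/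
theorem lintegral_exp_le (hν : IntegrableOn (fun z : ℝ => Real.exp z) (Set.Ioi 1) L.ν)
    {μ : Measure ℝ} [IsProbabilityMeasure μ] {t : ℝ≥0}
    (hμ : ∀ u, charFun μ u = Complex.exp ((t : ℂ) * L.exponent u)) :
    ∫⁻ x, ENNReal.ofReal (Real.exp x) ∂μ ≤ ENNReal.ofReal (Real.exp (t * L.beta)) := by
  -- Lévy's continuity theorem: convergence of characteristic functions gives weak convergence.
  have hweak : Tendsto (β := ProbabilityMeasure ℝ) (fun n => ⟨L.approxLaw t n, inferInstance⟩) atTop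
      (𝓝 ⟨μ, inferInstance⟩) := by
    refine ProbabilityMeasure.tendsto_of_tendsto_charFun fun u => ?_
    simpa only [ProbabilityMeasure.coe_mk, hμ] using L.tendsto_charFun_approxLaw t u
  have hlim : Tendsto (fun n => ∫⁻ x, ENNReal.ofReal (Real.exp x) ∂(L.approxLaw t n)) atTop
      (𝓝 (ENNReal.ofReal (Real.exp (t * L.beta)))) := by
    simp_rw [lintegral_exp_approxLaw hν]
    refine (ENNReal.continuous_ofReal.tendsto _).comp
      ((Real.continuous_exp.tendsto _).comp (Tendsto.const_mul _ ?_))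
    refine (Tendsto.const_add _ ?_).add_const _
    refine L.tendsto_integral_Icc_inter_bigJumps (C := 1) (by fun_prop) fun z hz => ?_
    have := Real.norm_exp_sub_one_sub_id_le (x := z) (abs_le.mpr hz)
    simpa using this
  -- The exponential is unbounded, so weak convergence is tested on `min (exp x) K`; monotone
  -- convergence in `K` then yields an inequality, which is all that is used.
  have htrunc : ∀ K : ℕ, ∫⁻ x, ENNReal.ofReal (min (Real.exp x) K) ∂μ ≤
      ENNReal.ofReal (Real.exp (t * L.beta)) := by
    intro K
    let g : BoundedContinuousFunction ℝ ℝ :=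
      BoundedContinuousFunction.ofNormedAddCommGroup
        (fun x => min (Real.exp x) K) (by fun_prop) K (fun x => by
          rw [Real.norm_of_nonneg (by positivity)]
          exact min_le_right _ _)
    have h1 := ProbabilityMeasure.tendsto_iff_forall_lintegral_tendsto.1 hweak g.nnrealPart
    refine le_of_tendsto_of_tendsto' h1 hlim fun n => lintegral_mono fun x => ?_
    exact ENNReal.ofReal_le_ofReal (min_le_left _ _)
  refine le_of_tendsto' (lintegral_tendsto_of_tendsto_of_monotone
    (f := fun (K : ℕ) x => ENNReal.ofReal (min (Real.exp x) K)) (fun K => by fun_prop) ?_ ?_) htrunc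
  · refine Eventually.of_forall fun x m n hmn => ENNReal.ofReal_le_ofReal ?_
    exact min_le_min le_rfl (by exact_mod_cast hmn)
  · refine Eventually.of_forall fun x => tendsto_const_nhds.congr' ?_
    filter_upwards [eventually_ge_atTop ⌈Real.exp x⌉₊] with K hK
    rw [min_eq_left (Nat.ceil_le.mp hK)]

end LevyTriplet

end CBRE

/-! ### Càdlàg paths -/

namespace CBRE

namespace IsCadlagPath

variable {ζ : ℝ≥0 → ℝ}

/-- One-sided limits give local boundedness at each point, and compactness of `[0, t]` makes it
uniform. -/
lemma exists_bound (hζ : IsCadlagPath ζ) (t : ℝ≥0) : ∃ B, 0 ≤ B ∧ ∀ s ≤ t, |ζ s| ≤ B := by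
  have key : ∃ B, ∀ s ∈ Set.Icc 0 t, |ζ s| ≤ B := by
    refine isCompact_Icc.induction_on (p := fun S => ∃ B, ∀ s ∈ S, |ζ s| ≤ B) ⟨0, by simp⟩
      (fun S T hST ⟨B, hB⟩ => ⟨B, fun s hs => hB s (hST hs)⟩) ?_ ?_
    · rintro S T ⟨B, hB⟩ ⟨B', hB'⟩
      refine ⟨max B B', fun s hs => ?_⟩
      rcases hs with hs | hs
      exacts [(hB s hs).trans (le_max_left _ _), (hB' s hs).trans (le_max_right _ _)]
    · intro s _
      obtain ⟨h1, y, h2⟩ := hζ s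
      have e1 : ∀ᶠ x in 𝓝[≥] s, |ζ x| < |ζ s| + 1 :=
        h1.abs.tendsto.eventually (gt_mem_nhds (lt_add_one _))
      have e2 : ∀ᶠ x in 𝓝[<] s, |ζ x| < |y| + 1 := h2.abs.eventually (gt_mem_nhds (lt_add_one _))
      have e3 : ∀ᶠ x in 𝓝 s, |ζ x| ≤ max (|ζ s| + 1) (|y| + 1) := by
        rw [← nhdsLT_sup_nhdsGE s, eventually_sup]
        exact ⟨e2.mono fun x hx => hx.le.trans (le_max_right _ _),
          e1.mono fun x hx => hx.le.trans (le_max_left _ _)⟩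
      exact ⟨_, mem_nhdsWithin_of_mem_nhds e3, _, fun x hx => hx⟩
  obtain ⟨B, hB⟩ := key
  exact ⟨B, (abs_nonneg _).trans (hB 0 ⟨le_rfl, zero_le⟩), fun s hs => hB s ⟨zero_le, hs⟩⟩

lemma measurable (hζ : IsCadlagPath ζ) : Measurable ζ := by
  -- The next grid point strictly to the right of `s`, so that right-continuity gives `ζ (d n s) → ζ
  -- s`. Each approximation depends on `s` only through an integer part, hence is measurable.
  let d : ℕ → ℝ≥0 → ℝ≥0 := fun n s => ((⌊((n : ℝ≥0) + 1) * s⌋₊ : ℝ≥0) + 1) / ((n : ℝ≥0) + 1)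
  have hle : ∀ n s, s ≤ d n s := fun n s => by
    rw [le_div_iff₀ (by positivity), mul_comm]
    exact (Nat.lt_floor_add_one _).le
  have hle' : ∀ n s, d n s ≤ s + 1 / ((n : ℝ≥0) + 1) := fun n s => by
    simp only [d]
    rw [div_le_iff₀ (by positivity), add_mul s, one_div_mul_cancel (by positivity), mul_comm s]
    gcongr
    exact Nat.floor_le zero_le
  have hlim : ∀ s, Tendsto (fun n => d n s) atTop (𝓝 s) := fun s => by
    refine tendsto_of_tendsto_of_tendsto_of_le_of_le tendsto_const_nhds ?_
      (fun n => hle n s) (fun n => hle' n s)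
    simpa using tendsto_const_nhds.add
      (NNReal.tendsto_coe.mp (by simpa using tendsto_one_div_add_atTop_nhds_zero_nat (𝕜 := ℝ)) :
        Tendsto (fun n : ℕ => 1 / ((n : ℝ≥0) + 1)) atTop (𝓝 0))
  refine measurable_of_tendsto_metrizable (f := fun n s => ζ (d n s)) (fun n => ?_) ?_
  · have hm : Measurable fun s : ℝ≥0 => ⌊((n : ℝ≥0) + 1) * s⌋₊ :=
      Nat.measurable_floor.comp (measurable_const_mul _)
    exact (measurable_from_nat
      (f := fun k : ℕ => ζ (((k : ℝ≥0) + 1) / ((n : ℝ≥0) + 1)))).comp hm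
  · refine tendsto_pi_nhds.mpr fun s => (hζ s).1.tendsto.comp ?_
    exact tendsto_nhdsWithin_iff.mpr ⟨hlim s, Eventually.of_forall fun n => hle n s⟩

end IsCadlagPath

/-! ### Bounds for the branching mechanism -/

lemma inner_plane (x y : Plane) : inner ℝ x y = x 0 * y 0 + x 1 * y 1 := by
  simp [PiLp.inner_apply, Fin.sum_univ_two, mul_comm]

lemma exp_neg_sub_one_add_nonneg (x : ℝ) : 0 ≤ Real.exp (-x) - 1 + x := by
  linarith [Real.add_one_le_exp (-x)]

lemma exp_neg_sub_one_add_le_sq {x : ℝ} (hx : 0 ≤ x) : Real.exp (-x) - 1 + x ≤ x ^ 2 := by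
  rcases le_total x 1 with h | h
  · have := Real.norm_exp_sub_one_sub_id_le (x := -x) (by simpa [abs_of_nonneg hx] using h)
    have h2 := (le_abs_self _).trans this
    simp only [sub_neg_eq_add, norm_neg, Real.norm_eq_abs, sq_abs] at h2
    exact h2
  · have := Real.exp_le_one_iff.mpr (neg_nonpos.mpr hx)
    nlinarith

/-- Discarding `b * z` in the exponential leaves a function of `a * y` that is both at most linear
and at most quadratic; this matches the moment conditions on `m`. -/
lemma exp_neg_sub_one_add_le {R a b y z : ℝ} (ha : 0 ≤ a) (haR : a ≤ R) (hb : 0 ≤ b)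
    (hbR : b ≤ R) (hy : 0 ≤ y) (hz : 0 ≤ z) :
    Real.exp (-(a * y + b * z)) - 1 + (a * y + b * z) ≤
      (R + R ^ 2) * (min y (y ^ 2) + z) := by
  have hR := ha.trans haR
  have hay : a * y ≤ R * y := by gcongr
  have hbz : b * z ≤ R * z := by gcongr
  have h0 : 0 ≤ a * y := by positivity
  have h1 : Real.exp (-(a * y + b * z)) ≤ Real.exp (-(a * y)) := by
    gcongr
    linarith [mul_nonneg hb hz]
  have h2 : Real.exp (-(a * y)) ≤ 1 := Real.exp_le_one_iff.mpr (by linarith)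
  have h3 := exp_neg_sub_one_add_le_sq h0
  have h4 : (a * y) ^ 2 ≤ (R * y) ^ 2 := by gcongr
  have h5 : 0 ≤ R ^ 2 * z := by positivity
  have h6 : 0 ≤ R ^ 2 * y := by positivity
  have h7 : 0 ≤ R * y ^ 2 := by positivity
  rcases min_choice y (y ^ 2) with h | h <;> rw [h] <;> nlinarith

namespace BranchingMechanism

variable (M : BranchingMechanism)

lemma le_phi (i : Fin 2) (l : Quadrant) : M.b i 0 * l.1 0 + M.b i 1 * l.1 1 ≤ M.phi i l := by
  have h1 : 0 ≤ M.c i * l.1 i ^ 2 := mul_nonneg (M.c_nonneg i) (sq_nonneg _)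
  have h2 : 0 ≤ ∫ z : Quadrant, (Real.exp (-(inner ℝ l.1 z.1)) - 1 + inner ℝ l.1 z.1) ∂(M.m i) :=
    integral_nonneg fun z => exp_neg_sub_one_add_nonneg _
  rw [phi]
  linarith

lemma measurable_phi (i : Fin 2) : Measurable (M.phi i) := by
  have := M.sigmaFinite_m i
  unfold phi
  refine Measurable.add (Continuous.measurable (by fun_prop)) ?_
  refine (StronglyMeasurable.integral_prod_right
    (f := fun (l z : Quadrant) => Real.exp (-(inner ℝ l.1 z.1)) - 1 + inner ℝ l.1 z.1) ?_).measurable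
  exact Continuous.stronglyMeasurable (by fun_prop)

/-- The index `k` is the type other than `i`; the existential treats both moment hypotheses at once.
-/
lemma integral_le_of_le {i : Fin 2} {R : ℝ} {l : Quadrant} (hl : ∀ j, l.1 j ≤ R) :
    ∃ (k : Fin 2), ∫ z : Quadrant, (Real.exp (-(inner ℝ l.1 z.1)) - 1 + inner ℝ l.1 z.1) ∂(M.m i) ≤
      (R + R ^ 2) * ∫ z : Quadrant, (min (z.1 i) (z.1 i ^ 2) + z.1 k) ∂(M.m i) := by
  have key : ∀ k, k ≠ i → Integrable (fun z : Quadrant => min (z.1 i) (z.1 i ^ 2) + z.1 k) (M.m i) →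
      ∫ z : Quadrant, (Real.exp (-(inner ℝ l.1 z.1)) - 1 + inner ℝ l.1 z.1) ∂(M.m i) ≤
      (R + R ^ 2) * ∫ z : Quadrant, (min (z.1 i) (z.1 i ^ 2) + z.1 k) ∂(M.m i) := by
    intro k hk h
    rw [← integral_const_mul]
    refine integral_mono_of_nonneg
      (Eventually.of_forall fun z => exp_neg_sub_one_add_nonneg _) (h.const_mul _)
      (Eventually.of_forall fun z => ?_)
    have hin : inner ℝ l.1 z.1 = l.1 i * z.1 i + l.1 k * z.1 k := by
      rw [inner_plane]
      fin_cases i <;> fin_cases k <;> first | exact absurd rfl hk | simp [add_comm]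
    simp only [hin]
    exact exp_neg_sub_one_add_le (l.2 i) (hl i) (l.2 k) (hl k) (z.2 i) (z.2 k)
  fin_cases i
  · exact ⟨1, key 1 (by decide) M.integrable_m_zero⟩
  · exact ⟨0, key 0 (by decide) M.integrable_m_one⟩

lemma exists_phi_bound (i : Fin 2) (R : ℝ) :
    ∃ C, ∀ l : Quadrant, (∀ j, l.1 j ≤ R) → |M.phi i l| ≤ C := by
  let I : Fin 2 → ℝ := fun k => ∫ z : Quadrant, (min (z.1 i) (z.1 i ^ 2) + z.1 k) ∂(M.m i)
  refine ⟨|M.b i 0| * R + |M.b i 1| * R + M.c i * R ^ 2 +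
    (R + R ^ 2) * (|I 0| + |I 1|), fun l hl => ?_⟩
  obtain ⟨k, hk⟩ := M.integral_le_of_le (i := i) hl
  have hR : 0 ≤ R := (l.2 0).trans (hl 0)
  have h0 : 0 ≤ ∫ z : Quadrant, (Real.exp (-(inner ℝ l.1 z.1)) - 1 + inner ℝ l.1 z.1) ∂(M.m i) :=
    integral_nonneg fun z => exp_neg_sub_one_add_nonneg _
  have hI : I k ≤ |I 0| + |I 1| := by
    fin_cases k
    · exact (le_abs_self _).trans (le_add_of_nonneg_right (abs_nonneg _))
    · exact (le_abs_self _).trans (le_add_of_nonneg_left (abs_nonneg _))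
  have h1 : ∀ j, |M.b i j * l.1 j| ≤ |M.b i j| * R := fun j => by
    rw [abs_mul, abs_of_nonneg (l.2 j)]
    exact mul_le_mul_of_nonneg_left (hl j) (abs_nonneg _)
  have h2 : |M.c i * l.1 i ^ 2| ≤ M.c i * R ^ 2 := by
    rw [abs_of_nonneg (mul_nonneg (M.c_nonneg i) (sq_nonneg _))]
    exact mul_le_mul_of_nonneg_left (pow_le_pow_left₀ (l.2 i) (hl i) 2) (M.c_nonneg i)
  rw [phi]
  refine (abs_add_le _ _).trans (add_le_add ((abs_add_le _ _).trans
    (add_le_add ((abs_add_le _ _).trans (add_le_add (h1 0) (h1 1))) h2)) ?_)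
  rw [abs_of_nonneg h0]
  exact hk.trans (mul_le_mul_of_nonneg_left hI (by positivity))

lemma b_zero_one_nonpos : M.b 0 1 ≤ 0 := by
  have h : 0 ≤ ∫ z : Quadrant, z.1 1 ∂(M.m 0) := integral_nonneg fun z => z.2 1
  linarith [M.b_zero_one]

lemma b_one_zero_nonpos : M.b 1 0 ≤ 0 := by
  have h : 0 ≤ ∫ z : Quadrant, z.1 0 ∂(M.m 1) := integral_nonneg fun z => z.2 0
  linarith [M.b_one_zero]

/-- Perron–Frobenius: below the smaller eigenvalue of `b` there are strictly positive
left subeigenvectors. -/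
lemma exists_left_subeigenvector {κ : ℝ} (hκ : κ < (M.b.trace - Real.sqrt M.disc) / 2) :
    ∃ p : Fin 2 → ℝ, (∀ i, 0 < p i) ∧
      ∀ j, κ * p j ≤ p 0 * M.b 0 j + p 1 * M.b 1 j := by
  have h01 := M.b_zero_one_nonpos
  have h10 := M.b_one_zero_nonpos
  have hd : M.disc = (M.b 0 0 - M.b 1 1) ^ 2 + 4 * (M.b 0 1 * M.b 1 0) := by
    rw [disc, Matrix.trace_fin_two, Matrix.det_fin_two]
    ring
  have hd' : (M.b 0 0 - M.b 1 1) ^ 2 ≤ M.disc := by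
    rw [hd]
    linarith [mul_nonneg_of_nonpos_of_nonpos h01 h10]
  have hs := Real.sq_sqrt ((sq_nonneg _).trans hd')
  have hsn := Real.sqrt_nonneg M.disc
  have habs : |M.b 0 0 - M.b 1 1| ≤ Real.sqrt M.disc := Real.abs_le_sqrt hd'
  rw [abs_le] at habs
  rw [Matrix.trace_fin_two] at hκ
  have h0 : 0 < M.b 0 0 - κ := by linarith
  -- The characteristic polynomial of `b` at `κ`, positive to the left of both roots.
  have hD : 0 < (M.b 0 0 - κ) * (M.b 1 1 - κ) - M.b 0 1 * M.b 1 0 := by nlinarith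
  set D := (M.b 0 0 - κ) * (M.b 1 1 - κ) - M.b 0 1 * M.b 1 0 with hDdef
  have hη : 0 < D / (1 - M.b 0 1) := div_pos hD (by linarith)
  have hη' : D / (1 - M.b 0 1) * (1 - M.b 0 1) = D := div_mul_cancel₀ _ (by linarith)
  -- With `η = D / (1 - b₀₁)`, the two columns of `p (b - κ)` equal `η (b₀₀ - κ)` and `η b₀₁ + D =
  -- η`. The slack `η > 0` keeps `p 0` positive even when `b₁₀ = 0`.
  refine ⟨![D / (1 - M.b 0 1) - M.b 1 0, M.b 0 0 - κ], ?_, ?_⟩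
  · intro i
    fin_cases i
    · simp only [Fin.zero_eta, Matrix.cons_val_zero]
      linarith
    · simpa using h0
  · intro j
    fin_cases j
    · simp only [Fin.zero_eta, Matrix.cons_val_zero, Matrix.cons_val_one]
      nlinarith [mul_pos hη h0]
    · simp only [Fin.mk_one, Matrix.cons_val_zero, Matrix.cons_val_one]
      nlinarith

end BranchingMechanism

end CBRE

namespace CBRE

/-! ### Comparison for the cumulant equation -/

/-- A backward Grönwall inequality in integral form. -/
lemma le_mul_exp_of_integral_le {w : ℝ → ℝ} (hw : Continuous w) {κ T : ℝ} (hT : 0 ≤ T)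
    (h : ∀ r ∈ Set.Icc 0 T, ∀ s ∈ Set.Icc 0 T, r ≤ s → κ * ∫ x in r..s, w x ≤ w s - w r) :
    w 0 ≤ w T * Real.exp (-κ * T) := by
  have hW : Continuous fun τ => w (T - τ) := by fun_prop
  -- Time reversal makes the inequality forward with rate `-κ`, of either sign. For `κ > 0` a bound
  -- from the terminal time alone would not force decay; increments over all subintervals control
  -- the right difference quotients.
  have key := le_gronwallBound_of_liminf_deriv_right_le (f := fun τ => w (T - τ))
    (f' := fun τ => -κ * w (T - τ)) (δ := w T) (K := -κ) (ε := 0) (a := 0) (b := T)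
    hW.continuousOn ?_ (by simp) (fun x _ => by simp) T ⟨hT, le_rfl⟩
  · simpa [gronwallBound_ε0] using key
  · intro x hx r hr
    have hd : HasDerivAt (fun y => -κ * ∫ τ in (0 : ℝ)..y, w (T - τ)) (-κ * w (T - x)) x :=
      (intervalIntegral.integral_hasDerivAt_right (hW.intervalIntegrable _ _)
        hW.stronglyMeasurable.stronglyMeasurableAtFilter hW.continuousAt).const_mul _
    have hs := (hasDerivWithinAt_iff_tendsto_slope' (s := Set.Ioi x) (by simp)).mp
      hd.hasDerivWithinAt
    refine Eventually.frequently ?_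
    filter_upwards [hs.eventually (gt_mem_nhds hr), Ioc_mem_nhdsGT hx.2] with z hz hzI
    refine lt_of_le_of_lt ?_ hz
    rw [slope_def_field, div_eq_inv_mul]
    refine mul_le_mul_of_nonneg_left ?_ (inv_nonneg.mpr (sub_nonneg.mpr hzI.1.le))
    have h1 := h (T - z) ⟨by linarith [hzI.2], by linarith [hx.1, hzI.1]⟩ (T - x)
      ⟨by linarith [hx.2], by linarith [hx.1]⟩ (by linarith [hzI.1])
    rw [← mul_sub, intervalIntegral.integral_interval_sub_left (hW.intervalIntegrable _ _)
      (hW.intervalIntegrable _ _), intervalIntegral.integral_comp_sub_left (fun y => w y)]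
    linarith

lemma continuous_expScale : Continuous fun q : ℝ × Quadrant => expScale q.1 q.2 :=
  Continuous.subtype_mk (by fun_prop) _

lemma expScale_apply (s : ℝ) (l : Quadrant) (i : Fin 2) :
    (expScale s l).1 i = Real.exp s * l.1 i := rfl

namespace BranchingMechanism

variable {M : BranchingMechanism} {ζ : ℝ≥0 → ℝ} {t : ℝ≥0} {l : Quadrant} {u : ℝ → Quadrant}

/-- The path and the solution are bounded on `[0, t]` and `phi` is bounded on bounded sets.
Integrability is what permits splitting the integral in the equation and writing increments of `u`
as integrals. -/
lemma IsCumulantSolution.integrableOn (hu : M.IsCumulantSolution ζ t l u) (hζ : IsCadlagPath ζ)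
    (i : Fin 2) :
    IntegrableOn (fun s => Real.exp (ζ s.toNNReal) * M.phi i (expScale (-ζ s.toNNReal) (u s)))
      (Set.Icc 0 (t : ℝ)) := by
  obtain ⟨B, hB0, hB⟩ := hζ.exists_bound t
  obtain ⟨U, hU⟩ := isCompact_Icc.exists_bound_of_continuousOn
    (f := fun s => (u s).1) (continuous_subtype_val.comp_continuousOn hu.1)
  obtain ⟨C, hC⟩ := M.exists_phi_bound i (Real.exp B * U)
  have hm : Measurable fun q : ℝ × Quadrant =>
      Real.exp q.1 * M.phi i (expScale (-q.1) q.2) := by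
    have h1 : Continuous fun q : ℝ × Quadrant => expScale (-q.1) q.2 :=
      continuous_expScale.comp (continuous_fst.neg.prodMk continuous_snd)
    exact (Real.measurable_exp.comp measurable_fst).mul
      ((M.measurable_phi i).comp h1.measurable)
  have hζm : Measurable fun s : ℝ => ζ s.toNNReal := hζ.measurable.comp measurable_real_toNNReal
  refine IntegrableOn.of_bound (C := Real.exp B * C) (by simp)
    (hm.comp_aemeasurable (hζm.aemeasurable.prodMk
      (hu.1.aemeasurable measurableSet_Icc))).aestronglyMeasurable ?_
  filter_upwards [ae_restrict_mem measurableSet_Icc] with s hs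
  have hζs := abs_le.mp (hB s.toNNReal (Real.toNNReal_le_iff_le_coe.mpr hs.2))
  rw [norm_mul, Real.norm_eq_abs, Real.abs_exp, Real.norm_eq_abs]
  refine mul_le_mul (Real.exp_le_exp.mpr hζs.2) (hC _ fun j => ?_) (abs_nonneg _)
    (Real.exp_pos _).le
  rw [expScale_apply]
  refine mul_le_mul (Real.exp_le_exp.mpr (by linarith)) ?_ ((u s).2 j) (Real.exp_pos _).le
  exact (le_abs_self _).trans ((PiLp.norm_apply_le _ j).trans (hU s hs))

/-- A left subeigenvector of `b` controls every solution of the cumulant equation. -/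
lemma IsCumulantSolution.le_mul_exp (hu : M.IsCumulantSolution ζ t l u) (hζ : IsCadlagPath ζ)
    {p : Fin 2 → ℝ} {κ : ℝ} (hp : ∀ i, 0 < p i)
    (hpb : ∀ j, κ * p j ≤ p 0 * M.b 0 j + p 1 * M.b 1 j) :
    p 0 * (u 0).1 0 + p 1 * (u 0).1 1 ≤
      (p 0 * l.1 0 + p 1 * l.1 1) * Real.exp (-κ * t) := by
  have ht : (0 : ℝ) ≤ t := t.2
  let g : Fin 2 → ℝ → ℝ := fun i s =>
    Real.exp (ζ s.toNNReal) * M.phi i (expScale (-ζ s.toNNReal) (u s))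
  have hg : ∀ i, ∀ r ∈ Set.Icc 0 (t : ℝ), ∀ s ∈ Set.Icc 0 (t : ℝ),
      IntervalIntegrable (g i) volume r s := fun i r hr s hs =>
    ((hu.integrableOn hζ i).mono_set (Set.uIcc_subset_Icc hr hs)).intervalIntegrable
  let v : ℝ → ℝ := fun r => p 0 * (u r).1 0 + p 1 * (u r).1 1
  have hv : ContinuousOn v (Set.Icc 0 (t : ℝ)) := by
    have hc : Continuous fun q : Quadrant => p 0 * q.1 0 + p 1 * q.1 1 := by fun_prop
    exact hc.comp_continuousOn hu.1
  -- Constant extension beyond `[0, t]`, since the Grönwall lemma asks for a globally continuous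
  -- function.
  let w : ℝ → ℝ := Set.IccExtend ht ((Set.Icc 0 (t : ℝ)).domRestrict v)
  have hw : Continuous w := (continuousOn_iff_continuous_domRestrict.mp hv).Icc_extend'
  have hwv : ∀ r ∈ Set.Icc 0 (t : ℝ), w r = v r := fun r hr => by
    simp only [w]
    rw [Set.IccExtend_of_mem _ _ hr]
    rfl
  have h0 : (0 : ℝ) ∈ Set.Icc 0 (t : ℝ) := ⟨le_rfl, ht⟩
  have h1 : (t : ℝ) ∈ Set.Icc 0 (t : ℝ) := ⟨ht, le_rfl⟩
  -- The factors `e^{ζ}` and `e^{-ζ}` cancel on the linear lower bound of `phi`, so the environment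
  -- disappears; then `p` is applied using `u ≥ 0`.
  have hbound : ∀ s, κ * v s ≤ p 0 * g 0 s + p 1 * g 1 s := by
    intro s
    have hi : ∀ i, M.b i 0 * (u s).1 0 + M.b i 1 * (u s).1 1 ≤ g i s := by
      intro i
      have := mul_le_mul_of_nonneg_left (M.le_phi i (expScale (-ζ s.toNNReal) (u s)))
        (Real.exp_pos (ζ s.toNNReal)).le
      refine le_trans (le_of_eq ?_) this
      have he : Real.exp (ζ s.toNNReal) * Real.exp (-ζ s.toNNReal) = 1 := by
        rw [← Real.exp_add, add_neg_cancel, Real.exp_zero]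
      simp only [expScale_apply]
      linear_combination (-(M.b i 0 * (u s).1 0 + M.b i 1 * (u s).1 1)) * he
    have e0 := mul_le_mul_of_nonneg_left (hi 0) (hp 0).le
    have e1 := mul_le_mul_of_nonneg_left (hi 1) (hp 1).le
    have f0 := mul_le_mul_of_nonneg_right (hpb 0) ((u s).2 0)
    have f1 := mul_le_mul_of_nonneg_right (hpb 1) ((u s).2 1)
    simp only [v]
    linarith
  have hend := hu.2 t h1
  simp only [intervalIntegral.integral_same, sub_zero] at hend
  have key := le_mul_exp_of_integral_le hw (κ := κ) ht ?_
  · rw [hwv 0 h0, hwv t h1] at key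
    simpa only [v, hend] using key
  · intro r hr s hs hrs
    have hdiff : ∀ i, (u s).1 i - (u r).1 i = ∫ x in r..s, g i x := by
      intro i
      rw [hu.2 s hs i, hu.2 r hr i,
        ← intervalIntegral.integral_add_adjacent_intervals (hg i r hr s hs) (hg i s hs t h1)]
      ring
    have hrhs : w s - w r = ∫ x in r..s, (p 0 * g 0 x + p 1 * g 1 x) := by
      rw [hwv s hs, hwv r hr, intervalIntegral.integral_add ((hg 0 r hr s hs).const_mul _)
        ((hg 1 r hr s hs).const_mul _), intervalIntegral.integral_const_mul,
        intervalIntegral.integral_const_mul, ← hdiff, ← hdiff]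
      simp only [v]
      ring
    rw [hrhs, ← intervalIntegral.integral_const_mul]
    refine intervalIntegral.integral_mono_on hrs ((hw.intervalIntegrable _ _).const_mul _)
      (((hg 0 r hr s hs).const_mul _).add ((hg 1 r hr s hs).const_mul _)) fun x hx => ?_
    rw [hwv x ⟨hr.1.trans hx.1, hx.2.trans hs.2⟩]
    exact hbound x

lemma cumulantV_le (M : BranchingMechanism) (hζ : IsCadlagPath ζ) (t : ℝ≥0) (l : Quadrant)
    {p : Fin 2 → ℝ} {κ : ℝ} (hp : ∀ i, 0 < p i)
    (hpb : ∀ j, κ * p j ≤ p 0 * M.b 0 j + p 1 * M.b 1 j) :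
    p 0 * (M.cumulantV ζ 0 t l).1 0 + p 1 * (M.cumulantV ζ 0 t l).1 1 ≤
      (p 0 * l.1 0 + p 1 * l.1 1) * Real.exp (ζ t - ζ 0 - κ * t) := by
  have hU : p 0 * (M.cumulantU ζ 0 t (expScale (ζ t) l)).1 0 +
      p 1 * (M.cumulantU ζ 0 t (expScale (ζ t) l)).1 1 ≤
      (p 0 * (expScale (ζ t) l).1 0 + p 1 * (expScale (ζ t) l).1 1) * Real.exp (-κ * t) := by
    unfold cumulantU
    split_ifs with h
    · simpa using h.choose_spec.le_mul_exp hζ hp hpb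
    -- Without a solution the cumulant takes its default value, the origin, and the bound is
    -- trivial.
    · have h0 := mul_nonneg (hp 0).le ((expScale (ζ t) l).2 0)
      have h1 := mul_nonneg (hp 1).le ((expScale (ζ t) l).2 1)
      simpa [origin] using mul_nonneg (add_nonneg h0 h1) (Real.exp_pos (-κ * t)).le
  have := mul_le_mul_of_nonneg_left hU (Real.exp_pos (-ζ 0)).le
  rw [show ζ t - ζ 0 - κ * t = -ζ 0 + ζ t + -κ * t by ring, Real.exp_add, Real.exp_add]
  simp only [cumulantV, expScale_apply] at this ⊢
  linarith

end BranchingMechanism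

/-! ### Wasserstein distances to the origin -/

lemma wasserstein_dOne_origin_le (μ : Measure Quadrant) [IsProbabilityMeasure μ] :
    wasserstein dOne μ (Measure.dirac origin) ≤ ∫⁻ y, ENNReal.ofReal ‖y.1‖ ∂μ := by
  have hm : Measurable fun y : Quadrant => (y, origin) := by fun_prop
  refine iInf₂_le_of_le (μ.map fun y => (y, origin)) ⟨?_, ?_⟩ ?_
  · rw [Measure.map_map measurable_fst hm]
    exact Measure.map_id
  · rw [Measure.map_map measurable_snd hm]
    exact (Measure.map_const μ origin).trans (by simp)
  · have hd : Measurable fun z : Quadrant × Quadrant => ENNReal.ofReal (dOne z.1 z.2) := by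
      unfold dOne
      fun_prop
    rw [lintegral_map hd hm]
    simp [dOne, origin]

/-- Every coupling of two Dirac masses is concentrated at `(x, y)`, so its cost is forced. -/
lemma le_wasserstein_dTheta_dirac (θ : ℝ) (x y : Quadrant) :
    ENNReal.ofReal ((1 + θ) * ‖x.1 - y.1‖) ≤
      wasserstein (dTheta θ) (Measure.dirac x) (Measure.dirac y) := by
  refine le_iInf₂ fun p hp => ?_
  have h1 : ∀ᵐ z ∂p, z.1 = x := by
    refine ae_of_ae_map (f := Prod.fst) (p := fun a => a = x) measurable_fst.aemeasurable ?_
    rw [hp.1, ae_dirac_eq]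
    rfl
  have h2 : ∀ᵐ z ∂p, z.2 = y := by
    refine ae_of_ae_map (f := Prod.snd) (p := fun a => a = y) measurable_snd.aemeasurable ?_
    rw [hp.2, ae_dirac_eq]
    rfl
  have hone : p Set.univ = 1 := by
    rw [← Set.preimage_univ (f := Prod.fst), ← Measure.map_apply measurable_fst .univ, hp.1]
    simp
  rw [lintegral_congr_ae (g := fun _ => ENNReal.ofReal ((1 + θ) * ‖x.1 - y.1‖))]
  · simp [hone]
  · filter_upwards [h1, h2] with z hz1 hz2
    rw [dTheta, hz1, hz2]

/-! ### The first moment of the semigroup -/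

lemma norm_le_add (y : Quadrant) : ‖y.1‖ ≤ y.1 0 + y.1 1 := by
  rw [EuclideanSpace.norm_eq, Fin.sum_univ_two, Real.sqrt_le_left (add_nonneg (y.2 0) (y.2 1))]
  simp only [Real.norm_eq_abs, sq_abs]
  nlinarith [mul_nonneg (y.2 0) (y.2 1)]

/-- The point `(ε, ε)`. -/
noncomputable def diag (ε : ℝ≥0) : Quadrant :=
  ⟨WithLp.toLp 2 fun _ => (ε : ℝ), fun _ => ε.2⟩

lemma inner_diag (ε : ℝ≥0) (y : Quadrant) :
    inner ℝ (diag ε).1 y.1 = ε * (y.1 0 + y.1 1) := by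
  rw [inner_plane]
  simp only [diag]
  ring

/-- Fatou's lemma along `ε = 1 / (n + 1)`: the quotient `(1 - e^{-ε(y₀ + y₁)}) / ε` tends to `y₀ +
y₁ ≥ ‖y‖`. Finiteness of the first moment is a conclusion, not an assumption. -/
lemma lintegral_norm_le_of_laplace (μ : Measure Quadrant) [IsProbabilityMeasure μ] {K : ℝ}
    (h : ∀ ε : ℝ≥0, 0 < ε →
      1 - ∫ y : Quadrant, Real.exp (-(inner ℝ (diag ε).1 y.1)) ∂μ ≤ ε * K) :
    ∫⁻ y, ENNReal.ofReal ‖y.1‖ ∂μ ≤ ENNReal.ofReal K := by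
  let ε : ℕ → ℝ≥0 := fun n => ((n : ℝ≥0) + 1)⁻¹
  have hε : ∀ n, 0 < ε n := fun n => by positivity
  let f : ℕ → Quadrant → ℝ := fun n y =>
    (ε n : ℝ)⁻¹ * (1 - Real.exp (-(inner ℝ (diag (ε n)).1 y.1)))
  have hf0 : ∀ n y, 0 ≤ f n y := fun n y => by
    refine mul_nonneg (by positivity) (sub_nonneg.mpr (Real.exp_le_one_iff.mpr ?_))
    rw [inner_diag, neg_nonpos]
    exact mul_nonneg (ε n).2 (add_nonneg (y.2 0) (y.2 1))
  have hint : ∀ n, Integrable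
      (fun y : Quadrant => Real.exp (-(inner ℝ (diag (ε n)).1 y.1))) μ := fun n => by
    refine Integrable.of_bound (C := 1)
      (Continuous.aestronglyMeasurable (by fun_prop)) (Eventually.of_forall fun y => ?_)
    rw [Real.norm_eq_abs, Real.abs_exp, Real.exp_le_one_iff, inner_diag, neg_nonpos]
    exact mul_nonneg (ε n).2 (add_nonneg (y.2 0) (y.2 1))
  have hfm : ∀ n, Measurable (f n) := fun n => Continuous.measurable (by fun_prop)
  have hfK : ∀ n, ∫⁻ y, ENNReal.ofReal (f n y) ∂μ ≤ ENNReal.ofReal K := fun n => by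
    have hfi : Integrable (f n) μ := ((integrable_const _).sub (hint n)).const_mul _
    rw [← ofReal_integral_eq_lintegral_ofReal hfi (Eventually.of_forall (hf0 n))]
    refine ENNReal.ofReal_le_ofReal ?_
    rw [integral_const_mul, integral_sub (integrable_const _) (hint n)]
    have hpos : (0 : ℝ) < ε n := hε n
    rw [inv_mul_le_iff₀ hpos]
    simpa using h (ε n) (hε n)
  have hlim : ∀ y : Quadrant, Tendsto (fun n => f n y) atTop (𝓝 (y.1 0 + y.1 1)) := by
    intro y
    have hd : HasDerivAt (fun r : ℝ => 1 - Real.exp (-(r * (y.1 0 + y.1 1))))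
        (y.1 0 + y.1 1) 0 := by
      have := ((((hasDerivAt_id (0 : ℝ)).mul_const (y.1 0 + y.1 1)).neg).exp).const_sub 1
      simpa using this
    have hs := hasDerivAt_iff_tendsto_slope_zero.mp hd
    have hε0 : Tendsto (fun n => (ε n : ℝ)) atTop (𝓝[≠] 0) := by
      refine tendsto_nhdsWithin_iff.mpr ⟨?_, Eventually.of_forall fun n => ?_⟩
      · simpa [ε] using tendsto_one_div_add_atTop_nhds_zero_nat (𝕜 := ℝ)
      · exact NNReal.coe_ne_zero.mpr (hε n).ne'
    refine (hs.comp hε0).congr fun n => ?_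
    simp only [Function.comp, f, inner_diag]
    simp
  calc ∫⁻ y, ENNReal.ofReal ‖y.1‖ ∂μ
      ≤ ∫⁻ y, liminf (fun n => ENNReal.ofReal (f n y)) atTop ∂μ := by
        refine lintegral_mono fun y => ?_
        rw [(ENNReal.tendsto_ofReal (hlim y)).liminf_eq]
        exact ENNReal.ofReal_le_ofReal (norm_le_add y)
    _ ≤ liminf (fun n => ∫⁻ y, ENNReal.ofReal (f n y) ∂μ) atTop :=
        lintegral_liminf_le fun n => (hfm n).ennreal_ofReal
    _ ≤ ENNReal.ofReal K := by
        refine (liminf_le_liminf (Eventually.of_forall hfK)).trans ?_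
        simp

variable {Ω : Type*} [MeasurableSpace Ω] {P : Measure Ω} [IsProbabilityMeasure P]
  {M : BranchingMechanism} {L : LevyTriplet} {ξ : ℝ≥0 → Ω → ℝ}
  {Q : ℝ≥0 → Kernel Quadrant Quadrant}

lemma IsLevyProcess.lintegral_exp_le (hξ : IsLevyProcess L P ξ)
    (hν : IntegrableOn (fun z : ℝ => Real.exp z) (Set.Ioi 1) L.ν) (t : ℝ≥0) :
    ∫⁻ ω, ENNReal.ofReal (Real.exp (ξ t ω)) ∂P ≤ ENNReal.ofReal (Real.exp (t * L.beta)) := by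
  have := Measure.isProbabilityMeasure_map (μ := P) (hξ.measurable t).aemeasurable
  have h := LevyTriplet.lintegral_exp_le hν (hξ.charFun_eq t)
  rwa [lintegral_map (by fun_prop) (hξ.measurable t)] at h

lemma IsLevyProcess.integrable_exp (hξ : IsLevyProcess L P ξ)
    (hν : IntegrableOn (fun z : ℝ => Real.exp z) (Set.Ioi 1) L.ν) (t : ℝ≥0) :
    Integrable (fun ω => Real.exp (ξ t ω)) P := by
  refine ⟨(Real.measurable_exp.comp (hξ.measurable t)).aestronglyMeasurable, ?_⟩
  rw [hasFiniteIntegral_iff_ofReal (Eventually.of_forall fun ω => (Real.exp_pos _).le)]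
  exact (hξ.lintegral_exp_le hν t).trans_lt ENNReal.ofReal_lt_top

lemma IsLevyProcess.integral_exp_le (hξ : IsLevyProcess L P ξ)
    (hν : IntegrableOn (fun z : ℝ => Real.exp z) (Set.Ioi 1) L.ν) (t : ℝ≥0) :
    ∫ ω, Real.exp (ξ t ω) ∂P ≤ Real.exp (t * L.beta) := by
  rw [← ENNReal.ofReal_le_ofReal_iff (Real.exp_pos _).le,
    ofReal_integral_eq_lintegral_ofReal (hξ.integrable_exp hν t)
      (Eventually.of_forall fun ω => (Real.exp_pos _).le)]
  exact hξ.lintegral_exp_le hν t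

/-- The first moment of the semigroup decays exponentially, up to a constant which depends
on a left subeigenvector of `b`. -/
lemma IsCBRESemigroup.lintegral_norm_le (hQ : IsCBRESemigroup M P ξ Q)
    (hξ : IsLevyProcess L P ξ)
    (hν : IntegrableOn (fun z : ℝ => Real.exp z) (Set.Ioi 1) L.ν)
    {p : Fin 2 → ℝ} {κ : ℝ} (hp : ∀ i, 0 < p i)
    (hpb : ∀ j, κ * p j ≤ p 0 * M.b 0 j + p 1 * M.b 1 j) (x : Quadrant) (t : ℝ≥0) :
    ∫⁻ y, ENNReal.ofReal ‖y.1‖ ∂(Q t x) ≤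
      ENNReal.ofReal ((p 0 + p 1) / min (p 0) (p 1) * ‖x.1‖ * Real.exp ((L.beta - κ) * t)) := by
  have := hQ.markov t
  refine lintegral_norm_le_of_laplace _ fun ε hε => ?_
  have hpm : 0 < min (p 0) (p 1) := lt_min (hp 0) (hp 1)
  set V : Ω → Quadrant := fun ω => M.cumulantV (fun s => ξ s ω) 0 t (diag ε) with hV
  have hlap := hQ.laplace t x (diag ε)
  have hpos : 0 < ∫ y : Quadrant, Real.exp (-(inner ℝ (diag ε).1 y.1)) ∂(Q t x) := by
    refine integral_exp_pos (Integrable.of_bound (C := 1)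
      (Continuous.aestronglyMeasurable (by fun_prop)) (Eventually.of_forall fun y => ?_))
    rw [Real.norm_eq_abs, Real.abs_exp, Real.exp_le_one_iff, inner_diag, neg_nonpos]
    exact mul_nonneg ε.2 (add_nonneg (y.2 0) (y.2 1))
  -- Measurability of the cumulant in `ω` is not known beforehand. A non-integrable function has
  -- integral `0` by convention, whereas the Laplace identity equates this integral with a positive
  -- number.
  have hint : Integrable (fun ω => Real.exp (-(inner ℝ x.1 (V ω).1))) P := by
    by_contra hn
    rw [hlap, integral_undef hn] at hpos
    exact lt_irrefl _ hpos
  rw [hlap, show (1 : ℝ) = ∫ _, (1 : ℝ) ∂P by simp, ← integral_sub (integrable_const _) hint]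
  have hbound : ∀ᵐ ω ∂P, 1 - Real.exp (-(inner ℝ x.1 (V ω).1)) ≤
      (ε * ((p 0 + p 1) / min (p 0) (p 1) * ‖x.1‖ * Real.exp (-κ * t))) * Real.exp (ξ t ω) := by
    filter_upwards [hξ.cadlag, hξ.zero] with ω hω hω0
    have h1 := M.cumulantV_le hω t (diag ε) hp hpb
    rw [hω0, sub_zero, sub_eq_add_neg, ← neg_mul, Real.exp_add, mul_comm (Real.exp (ξ t ω))] at h1
    have h2 : 1 - Real.exp (-(inner ℝ x.1 (V ω).1)) ≤ inner ℝ x.1 (V ω).1 := by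
      linarith [Real.add_one_le_exp (-(inner ℝ x.1 (V ω).1))]
    refine h2.trans ?_
    have h3 : inner ℝ x.1 (V ω).1 ≤ ‖x.1‖ * ((V ω).1 0 + (V ω).1 1) :=
      (real_inner_le_norm _ _).trans
        (mul_le_mul_of_nonneg_left (norm_le_add _) (norm_nonneg _))
    have h4 : min (p 0) (p 1) * ((V ω).1 0 + (V ω).1 1) ≤
        p 0 * (V ω).1 0 + p 1 * (V ω).1 1 := by
      rw [mul_add]
      exact add_le_add (mul_le_mul_of_nonneg_right (min_le_left _ _) ((V ω).2 0))
        (mul_le_mul_of_nonneg_right (min_le_right _ _) ((V ω).2 1))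
    -- Source of the constant: `p 0 + p 1` is the pairing of `p` with the test point `(ε, ε)` up to
    -- `ε`, and `min (p 0) (p 1)` is the price of returning from the `p`-weighted sum to the plain
    -- one.
    have h5 : (V ω).1 0 + (V ω).1 1 ≤
        (min (p 0) (p 1))⁻¹ * ((p 0 * ε + p 1 * ε) *
          (Real.exp (-κ * t) * Real.exp (ξ t ω))) := by
      rw [le_inv_mul_iff₀ hpm]
      exact h4.trans h1
    refine h3.trans ((mul_le_mul_of_nonneg_left h5 (norm_nonneg _)).trans (le_of_eq ?_))
    rw [div_eq_mul_inv]
    ring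
  refine (integral_mono_ae ((integrable_const _).sub hint)
    ((hξ.integrable_exp hν t).const_mul _) hbound).trans ?_
  rw [integral_const_mul]
  refine (mul_le_mul_of_nonneg_left (hξ.integral_exp_le hν t) ?_).trans (le_of_eq ?_)
  · have := hp 0
    have := hp 1
    positivity
  · rw [show (L.beta - κ) * t = -κ * t + t * L.beta by ring, Real.exp_add]
    ring

end CBRE

/-! ### Exponential contraction to the origin. -/

theorem mainTheorem5 {Ω : Type*} [MeasurableSpace Ω] (P : Measure Ω) [IsProbabilityMeasure P]
    (M : CBRE.BranchingMechanism) (L : CBRE.LevyTriplet)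
    (ξ : ℝ≥0 → Ω → ℝ) (hξ : CBRE.IsLevyProcess L P ξ)
    (Q : ℝ≥0 → Kernel CBRE.Quadrant CBRE.Quadrant) (hQ : CBRE.IsCBRESemigroup M P ξ Q)
    (hΔ : 0 < M.disc)
    (hν : IntegrableOn (fun z : ℝ => Real.exp z) (Set.Ioi 1) L.ν)
    (hβ : L.beta < (M.b.trace - Real.sqrt M.disc) / 2) :
    ∃ ρ : ℝ, 0 < ρ ∧ ∃ θ : ℝ, 0 < θ ∧ ∀ (x : CBRE.Quadrant) (t : ℝ≥0),
      CBRE.wasserstein CBRE.dOne ((Measure.dirac x).bind (Q t)) (Measure.dirac CBRE.origin) ≤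
        CBRE.wasserstein (CBRE.dTheta θ) (Measure.dirac x) (Measure.dirac CBRE.origin) *
          ENNReal.ofReal (Real.exp (-ρ * t)) := by
  obtain ⟨κ, hκ, hκ'⟩ := exists_between hβ
  obtain ⟨p, hp, hpb⟩ := M.exists_left_subeigenvector hκ'
  have h0 := hp 0
  have h1 := hp 1
  have hθ : 0 < (p 0 + p 1) / min (p 0) (p 1) := by positivity
  -- The moment constant itself serves as `θ`, since it is at most `1 + θ`.
  refine ⟨κ - L.beta, sub_pos.mpr hκ, (p 0 + p 1) / min (p 0) (p 1), hθ, fun x t => ?_⟩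
  have := hQ.markov t
  rw [Measure.dirac_bind (Q t).measurable]
  refine (CBRE.wasserstein_dOne_origin_le _).trans
    ((hQ.lintegral_norm_le hξ hν hp hpb x t).trans ?_)
  rw [neg_sub, ENNReal.ofReal_mul (by positivity)]
  gcongr
  refine le_trans (ENNReal.ofReal_le_ofReal ?_) (CBRE.le_wasserstein_dTheta_dirac _ _ _)
  have : CBRE.origin.1 = 0 := rfl
  rw [this, sub_zero]
  gcongr
  linarith
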